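/- Let $(\Omega,\mathcal F_\infty,\mathbb P)$ be a probability space with a filtration $(\mathcal F_t)_{t\in\{0,1,2,\dots\}}$ such that $\mathcal F_0$ is trivial (every event in $\mathcal F_0$ has probability $0$ or $1$), and let $P=(P_t)_{t\ge 0}$ be an adapted process with values in $\mathbb R^n$ (the prices of $n$ assets; no sign or integrability condition is imposed). Write $a\cdot b=\sum_{i=1}^n a^ib^i$. An investment-consumption strategy is a predictable $\mathbb R^n$-valued process $H=(H_t)_{t\ge 1}$ (so $H_t$ is $\mathcal F_{t-1}$-measurable) with $H_t\cdot P_t\ge H_{t+1}\cdot P_t$ almost surely for all $t\ge 1$. It is a pure-investment strategy if $(H_t-H_{t+1})\cdot P_t=0$ almost surely for all $t\ge 1$. An (investment-consumption) arbitrage is an investment-consumption strategy $H$ for which there is a non-random $T>0$ with $H_1\cdot P_0\le 0$ and $H_{T+1}=0$ almost surely and $\mathbb P\big((H_t-H_{t+1})\cdot P_t>0\text{ for some }0\le t\le T\big)>0$, where $H_0=0$. The market is complete if for every $T>0$ and every real-valued $\mathcal F_T$-measurable random variable $\xi_T$ there is a pure-investment strategy $H$ with $H_T\cdot P_T=\xi_T$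 almost surely. A martingale deflator is a strictly positive adapted real-valued process $Y=(Y_t)_{t\ge 0}$ such that $(P_tY_t)_{t\ge 0}$ is an ($n$-dimensional) martingale. **Theorem.** Suppose that the market has no arbitrage. Then the market is complete if and only if there is exactly one martingale deflator $Y$ with $Y_0=1$ almost surely, where processes are identified if they are almost surely equal at all times. -/

import Mathlib

open MeasureTheory

namespace MarketModel

variable {Ω : Type*} {m : MeasurableSpace Ω} {n : ℕ}

/-- An investment-consumption strategy for the `n`-dimensional price process `P`: a predictable
process `H` (so that `H (t + 1)` is `ℱ t`-measurable) which is self-financing, that is,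
`H_t · P_t ≥ H_{t+1} · P_t` almost surely for all `t ≥ 1`. -/
def IsInvestmentConsumption (μ : Measure Ω) (ℱ : Filtration ℕ m) (P : ℕ → Ω → Fin n → ℝ)
    (H : ℕ → Ω → Fin n → ℝ) : Prop :=
  IsStronglyPredictable ℱ H ∧
    ∀ t, 1 ≤ t → ∀ᵐ ω ∂μ, H (t + 1) ω ⬝ᵥ P t ω ≤ H t ω ⬝ᵥ P t ω

/-- The set of strategies that are feasible with initial wealth `x` over the horizon `T`:
self-financing, `H_1 · P_0 ≤ x` and `H_{T+1} = 0`. -/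
def Feasible (μ : Measure Ω) (ℱ : Filtration ℕ m) (P : ℕ → Ω → Fin n → ℝ) (x : ℝ) (T : ℕ) :
    Set (ℕ → Ω → Fin n → ℝ) :=
  {H | IsInvestmentConsumption μ ℱ P H ∧ (∀ᵐ ω ∂μ, H 1 ω ⬝ᵥ P 0 ω ≤ x) ∧
    ∀ᵐ ω ∂μ, H (T + 1) ω = 0}

/-- An investment-consumption arbitrage: for some non-random horizon `T > 0` it is feasible with
zero initial wealth, and with positive probability it consumes at some time `0 ≤ t ≤ T`,
where `H_0 = 0`. -/
def IsArbitrage (μ : Measure Ω) (ℱ : Filtration ℕ m) (P : ℕ → Ω → Fin n → ℝ)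
    (H : ℕ → Ω → Fin n → ℝ) : Prop :=
  H 0 = 0 ∧ ∃ T : ℕ, 0 < T ∧ H ∈ Feasible μ ℱ P 0 T ∧
    0 < μ {ω | ∃ t, t ≤ T ∧ 0 < (H t ω - H (t + 1) ω) ⬝ᵥ P t ω}

/-- The market has no investment-consumption arbitrage. -/
def NoArbitrage (μ : Measure Ω) (ℱ : Filtration ℕ m) (P : ℕ → Ω → Fin n → ℝ) : Prop :=
  ¬ ∃ H, IsArbitrage μ ℱ P H

/-- A martingale deflator: a strictly positive adapted process `Y` such that `P Y` is an
`n`-dimensional martingale. -/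
def IsMartingaleDeflator (μ : Measure Ω) (ℱ : Filtration ℕ m) (P : ℕ → Ω → Fin n → ℝ)
    (Y : ℕ → Ω → ℝ) : Prop :=
  StronglyAdapted ℱ Y ∧ (∀ t, ∀ᵐ ω ∂μ, 0 < Y t ω) ∧
    Martingale (fun t ω => Y t ω • P t ω) ℱ μ

/-- A pure-investment strategy: `(H_t - H_{t+1}) · P_t = 0` almost surely for all `t ≥ 1`, with
the convention `H_0 = H_1`. -/
def IsPureInvestment (μ : Measure Ω) (ℱ : Filtration ℕ m) (P : ℕ → Ω → Fin n → ℝ)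
    (H : ℕ → Ω → Fin n → ℝ) : Prop :=
  IsInvestmentConsumption μ ℱ P H ∧ H 0 = H 1 ∧
    ∀ t, 1 ≤ t → ∀ᵐ ω ∂μ, (H t ω - H (t + 1) ω) ⬝ᵥ P t ω = 0

/-- The market is complete: for every `T > 0`, every `ℱ T`-measurable real random variable is
the time-`T` value of a pure-investment strategy. -/
def IsComplete (μ : Measure Ω) (ℱ : Filtration ℕ m) (P : ℕ → Ω → Fin n → ℝ) : Prop :=
  ∀ T : ℕ, 0 < T → ∀ ξ : Ω → ℝ, Measurable[ℱ T] ξ →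
    ∃ H, IsPureInvestment μ ℱ P H ∧ ∀ᵐ ω ∂μ, H T ω ⬝ᵥ P T ω = ξ ω

end MarketModel

/-! Completeness yields the deflator. Absence of arbitrage gives the law of one price, so in a
complete market the replication cost at horizon T is a strictly positive linear functional on all `ℱ
T`-measurable functions; it is a number because `ℱ 0` is trivial. Strict positivity on so large a
space forces every such function to be essentially bounded (`exists_bddMeas_ae_eq`): otherwise a
fast-growing function would have infinite price. Hence integrability is automatic. Positivity also
gives L² continuity, so Riesz supplies a density (`exists_density_of_monotone`), and the densities
at the various horizons form the deflator. Replicating the difference of two deflators shows that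
its square has mean zero.

Conversely, suppose a bounded nonzero Z, known at t+1, is orthogonal given `ℱ t` to the deflated
prices at t+1. Multiplying the deflator by 1 + cZ from t+1 on gives another one. Uniqueness
therefore excludes such Z, and a conditional least-squares projection (`exists_cond_projection`)
writes every claim at t+1 as an `ℱ t`-measurable combination of the prices. One-period replications
are then chained backwards. -/

namespace MarketModel

/-! ### Conditional least squares with bounded coefficients -/

/-- The algebra of bounded real functions measurable with respect to `G`. -/
def bddMeas {Ω : Type*} (G : MeasurableSpace Ω) : Subalgebra ℝ (Ω → ℝ) where
  carrier := {f | Measurable[G] f ∧ ∃ C, ∀ ω, |f ω| ≤ C}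
  mul_mem' := by
    rintro f g ⟨hf, C, hC⟩ ⟨hg, D, hD⟩
    refine ⟨hf.mul hg, C * D, fun ω => ?_⟩
    rw [Pi.mul_apply, abs_mul]
    exact mul_le_mul (hC ω) (hD ω) (abs_nonneg _) ((abs_nonneg _).trans (hC ω))
  add_mem' := by
    rintro f g ⟨hf, C, hC⟩ ⟨hg, D, hD⟩
    exact ⟨hf.add hg, C + D, fun ω => (abs_add_le _ _).trans (add_le_add (hC ω) (hD ω))⟩
  algebraMap_mem' r := ⟨measurable_const, |r|, fun _ => le_rfl⟩

variable {Ω : Type*} {G m : MeasurableSpace Ω}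

lemma bddMeas_mono {F : MeasurableSpace Ω} (h : G ≤ F) {f : Ω → ℝ} (hf : f ∈ bddMeas G) :
    f ∈ bddMeas F :=
  ⟨hf.1.mono h le_rfl, hf.2⟩

lemma integrable_of_mem_bddMeas {μ : Measure Ω} [IsFiniteMeasure μ] {f : Ω → ℝ}
    (hf : f ∈ bddMeas m) : Integrable f μ := by
  obtain ⟨hm, C, hC⟩ := hf
  exact Integrable.of_bound hm.aestronglyMeasurable C (ae_of_all _ hC)

lemma indicator_mem_bddMeas {s : Set Ω} (hs : MeasurableSet[G] s) :
    s.indicator (1 : Ω → ℝ) ∈ bddMeas G := by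
  refine ⟨(measurable_one.indicator hs), 1, fun ω => ?_⟩
  by_cases h : ω ∈ s <;> simp [h]

/-- A bounded version of the conditional expectation of a bounded function. -/
lemma exists_bddMeas_condExp {μ : Measure Ω} [IsFiniteMeasure μ] (hG : G ≤ m) {h : Ω → ℝ}
    (hh : h ∈ bddMeas m) :
    ∃ c ∈ bddMeas G, ∀ g ∈ bddMeas G, ∫ ω, (g * h) ω ∂μ = ∫ ω, (g * c) ω ∂μ := by
  obtain ⟨hm, C, hC⟩ := id hh
  have hint : Integrable h μ := integrable_of_mem_bddMeas hh
  have hCb : ∀ᵐ ω ∂μ, |(μ[h|G]) ω| ≤ C.toNNReal :=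
    ae_bdd_abs_condExp_of_ae_bdd_abs (ae_of_all _ fun ω => (hC ω).trans (Real.le_coe_toNNReal C))
  -- Clipping changes the conditional expectation only on a null set and makes the bound hold
  -- everywhere, as `bddMeas` demands.
  refine ⟨fun ω => max (-(C.toNNReal : ℝ)) (min C.toNNReal ((μ[h|G]) ω)), ⟨?_, C.toNNReal, ?_⟩, ?_⟩
  · exact measurable_const.max (measurable_const.min stronglyMeasurable_condExp.measurable)
  · intro ω
    rw [abs_le]
    exact ⟨le_max_left _ _, max_le (by linarith [C.toNNReal.2]) (min_le_left _ _)⟩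
  · rintro g ⟨hg, D, hD⟩
    have h1 := condExp_stronglyMeasurable_mul_of_bound hG (μ := μ) hg.stronglyMeasurable hint D
      (ae_of_all _ hD)
    rw [← integral_condExp hG (f := g * h)]
    refine integral_congr_ae ?_
    filter_upwards [h1, hCb] with ω h1 h2
    rw [abs_le] at h2
    rw [h1, Pi.mul_apply, Pi.mul_apply, min_eq_right h2.2, max_eq_right h2.1]

/-- Conditional least squares: after scaling by a positive `G`-measurable weight, `ξ` differs from
a `G`-measurable combination of the `Q i` by something conditionally orthogonal to all `Q i`. -/
theorem exists_cond_projection (μ : Measure Ω) [IsFiniteMeasure μ] (hG : G ≤ m) (n : ℕ)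
    (Q : Fin n → Ω → ℝ) (hQ : ∀ i, Q i ∈ bddMeas m) (ξ : Ω → ℝ) (hξ : ξ ∈ bddMeas m) :
    ∃ w ∈ bddMeas G, ∃ K : Fin n → Ω → ℝ, (∀ i, K i ∈ bddMeas G) ∧ (∀ ω, 0 < w ω) ∧
      ∀ i, ∀ g ∈ bddMeas G, ∫ ω, (g * ((w * ξ - ∑ j, K j * Q j) * Q i)) ω ∂μ = 0 := by
  have up : ∀ {f : Ω → ℝ}, f ∈ bddMeas G → f ∈ bddMeas m := fun hf => bddMeas_mono hG hf
  -- Gram–Schmidt over the `G`-measurable functions: R and S are the residuals of the last Q and of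
  -- ξ after projection on the other Q's, and S is then projected on R. Division by d = E[R² | G] is
  -- replaced by multiplication, which is why the statement carries a weight.
  induction n generalizing ξ with
  | zero =>
    exact ⟨1, one_mem _, fun _ => 0, fun _ => zero_mem _, fun _ => one_pos, fun i => i.elim0⟩
  | succ n ih =>
    obtain ⟨w₁, hw₁, K₁, hK₁, hpos₁, h₁⟩ :=
      ih (fun i => Q i.castSucc) (fun i => hQ _) (Q (Fin.last n)) (hQ _)
    obtain ⟨w₂, hw₂, K₂, hK₂, hpos₂, h₂⟩ := ih (fun i => Q i.castSucc) (fun i => hQ _) ξ hξ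
    set q := Q (Fin.last n) with hq
    set A₁ := ∑ j : Fin n, K₁ j * Q j.castSucc with hA₁
    set A₂ := ∑ j : Fin n, K₂ j * Q j.castSucc with hA₂
    have mA₁ : A₁ ∈ bddMeas m := sum_mem fun i _ => mul_mem (up (hK₁ i)) (hQ _)
    have mA₂ : A₂ ∈ bddMeas m := sum_mem fun i _ => mul_mem (up (hK₂ i)) (hQ _)
    set R := w₁ * q - A₁ with hR
    set S := w₂ * ξ - A₂ with hS
    have mR : R ∈ bddMeas m := sub_mem (mul_mem (up hw₁) (hQ _)) mA₁
    have mS : S ∈ bddMeas m := sub_mem (mul_mem (up hw₂) hξ) mA₂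
    obtain ⟨c, hc, hcI⟩ := exists_bddMeas_condExp (μ := μ) hG (mul_mem mS mR)
    obtain ⟨d, hd, hdI⟩ := exists_bddMeas_condExp (μ := μ) hG (mul_mem mR mR)
    have hD : MeasurableSet[G] {ω | d ω ≤ 0} := measurableSet_le hd.1 measurable_const
    -- Where d ≤ 0 the residual R vanishes almost surely, so there the weight d can be replaced by 1
    -- to keep it positive.
    set e : Ω → ℝ := Set.indicator {ω | d ω ≤ 0} 1 with he
    have me : e ∈ bddMeas G := indicator_mem_bddMeas hD
    have hint : ∀ {f : Ω → ℝ}, f ∈ bddMeas m → Integrable f μ := integrable_of_mem_bddMeas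
    have heR : e * R =ᵐ[μ] 0 := by
      have h0 : ∫ ω, ((e * R) * (e * R)) ω ∂μ ≤ 0 := by
        have : (e * R) * (e * R) = e * (R * R) := by
          funext ω
          by_cases h : d ω ≤ 0 <;> simp [he, h]
        rw [this, hdI e me]
        refine integral_nonpos fun ω => ?_
        by_cases h : d ω ≤ 0
        · simp [he, h]
        · simp [he, h]
      have h1 : (0 : Ω → ℝ) ≤ (e * R) * (e * R) := fun ω => mul_self_nonneg _
      have meR := mul_mem (up me) mR
      have h2 := (integral_eq_zero_iff_of_nonneg h1 (hint (mul_mem meR meR))).1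
        (le_antisymm h0 (integral_nonneg h1))
      filter_upwards [h2] with ω h2
      exact mul_self_eq_zero.1 h2
    set w₃ : Ω → ℝ := d + e * (1 - d) with hw₃
    have mw₃ : w₃ ∈ bddMeas G := add_mem hd (mul_mem me (sub_mem (one_mem _) hd))
    have hpos₃ : ∀ ω, 0 < w₃ ω := by
      intro ω
      by_cases h : d ω ≤ 0
      · simp [hw₃, he, h]
      · simpa [hw₃, he, h] using lt_of_not_ge h
    set U := w₃ * S - c * R with hU
    have mU : U ∈ bddMeas m := sub_mem (mul_mem (up mw₃) mS) (mul_mem (up hc) mR)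
    have hUR : ∀ g ∈ bddMeas G, ∫ ω, (g * (U * R)) ω ∂μ = 0 := by
      intro g hg
      have e1 : g * (U * R) = (g * w₃) * (S * R) - (g * c) * (R * R) := by rw [hU]; ring
      have e2 : (g * w₃) * c - (g * c) * d = (g * (1 - d) * e) * c := by rw [hw₃]; ring
      rw [e1, integral_sub' (hint (mul_mem (up (mul_mem hg mw₃)) (mul_mem mS mR)))
        (hint (mul_mem (up (mul_mem hg hc)) (mul_mem mR mR))), hcI _ (mul_mem hg mw₃),
        hdI _ (mul_mem hg hc), ← integral_sub' (hint (up (mul_mem (mul_mem hg mw₃) hc)))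
        (hint (up (mul_mem (mul_mem hg hc) hd))), e2,
        ← hcI _ (mul_mem (mul_mem hg (sub_mem (one_mem _) hd)) me)]
      refine integral_eq_zero_of_ae ?_
      filter_upwards [heR] with ω hω
      have : e ω * R ω = 0 := hω
      simp only [Pi.mul_apply, Pi.zero_apply]
      linear_combination (g ω * (1 - d) ω * S ω) * this
    have hUQ : ∀ i : Fin n, ∀ g ∈ bddMeas G, ∫ ω, (g * (U * Q i.castSucc)) ω ∂μ = 0 := by
      intro i g hg
      have e1 : g * (U * Q i.castSucc) =
          (g * w₃) * (S * Q i.castSucc) - (g * c) * (R * Q i.castSucc) := by rw [hU]; ring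
      rw [e1, integral_sub' (hint (mul_mem (up (mul_mem hg mw₃)) (mul_mem mS (hQ _))))
        (hint (mul_mem (up (mul_mem hg hc)) (mul_mem mR (hQ _)))), h₁ i _ (mul_mem hg hc),
        h₂ i _ (mul_mem hg mw₃), sub_zero]
    have hUA : ∀ g ∈ bddMeas G, ∫ ω, (g * (U * A₁)) ω ∂μ = 0 := by
      intro g hg
      have e1 : g * (U * A₁) = ∑ j, (g * K₁ j) * (U * Q j.castSucc) := by
        rw [hA₁, Finset.mul_sum, Finset.mul_sum]
        exact Finset.sum_congr rfl fun j _ => by ring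
      rw [e1]
      simp only [Finset.sum_apply]
      rw [integral_finsetSum _ fun j _ =>
        hint (mul_mem (up (mul_mem hg (hK₁ j))) (mul_mem mU (hQ j.castSucc)))]
      exact Finset.sum_eq_zero fun j _ => hUQ j _ (mul_mem hg (hK₁ j))
    obtain ⟨v, hv, hvI⟩ := exists_bddMeas_condExp (μ := μ) hG (mul_mem mU (hQ (Fin.last n)))
    have hUq : ∀ g ∈ bddMeas G, ∫ ω, (g * (U * q)) ω ∂μ = 0 := by
      -- Since w₁q = R + A₁, U is orthogonal to w₁q. The inverse of w₁ need not be bounded, so w₁ is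
      -- removed by testing against v = E[Uq | G] itself.
      have hw : ∀ g ∈ bddMeas G, ∫ ω, (g * w₁ * v) ω ∂μ = 0 := by
        intro g hg
        rw [← hvI _ (mul_mem hg hw₁)]
        have e1 : g * w₁ * (U * q) = g * (U * R) + g * (U * A₁) := by rw [hR]; ring
        rw [e1, integral_add' (hint (mul_mem (up hg) (mul_mem mU mR)))
          (hint (mul_mem (up hg) (mul_mem mU mA₁))), hUR g hg, hUA g hg, add_zero]
      have h0 : v * w₁ * v =ᵐ[μ] 0 :=
        (integral_eq_zero_iff_of_nonneg
          (fun ω => by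
            have : (v * w₁ * v) ω = w₁ ω * (v ω * v ω) := by simp only [Pi.mul_apply]; ring
            rw [this]
            exact mul_nonneg (hpos₁ ω).le (mul_self_nonneg _))
          (hint (up (mul_mem (mul_mem hv hw₁) hv)))).1 (hw v hv)
      intro g hg
      rw [hvI g hg]
      refine integral_eq_zero_of_ae ?_
      filter_upwards [h0] with ω hω
      have h3 : v ω * w₁ ω * v ω = 0 := hω
      have : v ω = 0 := by
        rcases mul_eq_zero.1 h3 with h | h
        · exact (mul_eq_zero.1 h).resolve_right (hpos₁ ω).ne'
        · exact h
      simp [this]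
    -- The coefficients come from expanding U = w₃(w₂ξ − A₂) − c(w₁q − A₁).
    refine ⟨w₃ * w₂, mul_mem mw₃ hw₂, Fin.snoc (α := fun _ => Ω → ℝ)
      (fun j => w₃ * K₂ j - c * K₁ j) (c * w₁), ?_, fun ω => mul_pos (hpos₃ ω) (hpos₂ ω), ?_⟩
    · intro i
      refine Fin.lastCases ?_ (fun j => ?_) i
      · simpa using mul_mem hc hw₁
      · simpa using sub_mem (mul_mem mw₃ (hK₂ j)) (mul_mem hc (hK₁ j))
    · have key : w₃ * w₂ * ξ - ∑ j, (Fin.snoc (α := fun _ => Ω → ℝ)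
          (fun j => w₃ * K₂ j - c * K₁ j) (c * w₁) : Fin (n + 1) → Ω → ℝ) j * Q j = U := by
        rw [Fin.sum_univ_castSucc]
        simp only [Fin.snoc_castSucc, Fin.snoc_last, sub_mul, Finset.sum_sub_distrib]
        simp only [mul_assoc]
        rw [← Finset.mul_sum, ← Finset.mul_sum, ← hA₁, ← hA₂, hU, hS, hR, hq]
        ring
      intro i
      rw [key]
      exact Fin.lastCases hUq hUQ i

end MarketModel

/-! ### Uniqueness of the deflator implies completeness -/

namespace MarketModel

variable {Ω : Type*} {m : MeasurableSpace Ω} {n : ℕ}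

/-- A process is a martingale iff its increments are orthogonal to all bounded functions of the
past, coordinate by coordinate. -/
lemma martingale_pi_iff {μ : Measure Ω} [IsFiniteMeasure μ] {ℱ : Filtration ℕ m}
    {f : ℕ → Ω → Fin n → ℝ} :
    Martingale f ℱ μ ↔ StronglyAdapted ℱ f ∧ (∀ t i, Integrable (fun ω => f t ω i) μ) ∧
      ∀ t i, ∀ g ∈ bddMeas (ℱ t), ∫ ω, g ω * f (t + 1) ω i ∂μ = ∫ ω, g ω * f t ω i ∂μ := by
  constructor
  · intro h
    have hi : ∀ t i, Integrable (fun ω => f t ω i) μ := fun t i => (h.integrable t).eval i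
    refine ⟨h.1, hi, ?_⟩
    rintro t i g ⟨hg, C, hC⟩
    have h1 : f t =ᵐ[μ] μ[f (t + 1)|ℱ t] := (h.condExp_ae_eq t.le_succ).symm
    have h2 := (ContinuousLinearMap.proj (R := ℝ) (φ := fun _ : Fin n => ℝ) i).comp_condExp_comm
      (h.integrable (t + 1)) (m := ℱ t)
    have h3 := condExp_stronglyMeasurable_mul_of_bound (ℱ.le t) (μ := μ) hg.stronglyMeasurable
      (hi (t + 1) i) C (ae_of_all _ hC)
    change ∫ ω, (g * fun ω => f (t + 1) ω i) ω ∂μ = _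
    rw [← integral_condExp (ℱ.le t)]
    refine integral_congr_ae ?_
    filter_upwards [h1, h2, h3] with ω h1 h2 h3
    rw [h3, h1, Pi.mul_apply]
    exact congrArg (g ω * ·) h2.symm
  · rintro ⟨ha, hi, hI⟩
    have hint : ∀ t, Integrable (f t) μ := fun t => Integrable.of_eval (hi t)
    refine martingale_nat ha hint fun t => ?_
    have key : ∀ i, (fun ω => f t ω i) =ᵐ[μ] μ[fun ω => f (t + 1) ω i|ℱ t] := by
      intro i
      refine ae_eq_condExp_of_forall_setIntegral_eq (ℱ.le t) (hi (t + 1) i)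
        (fun s _ _ => (hi t i).integrableOn) (fun s hs _ => ?_) ?_
      · have h := hI t i _ (indicator_mem_bddMeas hs)
        rw [← integral_indicator (ℱ.le t _ hs), ← integral_indicator (ℱ.le t _ hs)]
        have e : ∀ u, (fun ω => s.indicator (1 : Ω → ℝ) ω * f u ω i) =
            s.indicator fun ω => f u ω i := by
          intro u
          funext ω
          by_cases hω : ω ∈ s <;> simp [hω]
        rw [e, e] at h
        exact h.symm
      · exact ((measurable_pi_apply i).comp (ha t).measurable).aestronglyMeasurable
    have h2 := fun i => (ContinuousLinearMap.proj (R := ℝ)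
      (φ := fun _ : Fin n => ℝ) i).comp_condExp_comm (hint (t + 1)) (m := ℱ t)
    filter_upwards [ae_all_iff.2 key, ae_all_iff.2 h2] with ω h1 h2
    funext i
    rw [h1 i]
    exact (h2 i).symm

/-- If nothing bounded and nonzero is conditionally orthogonal to all `Q i`, then the `Q i` span
all measurable functions with `G`-measurable coefficients. -/
theorem exists_coeff_of_orthogonal_eq_zero {Ω : Type*} {G F m : MeasurableSpace Ω}
    {μ : Measure Ω} [IsFiniteMeasure μ] (hGF : G ≤ F) (hF : F ≤ m) (Q : Fin n → Ω → ℝ)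
    (hQ : ∀ i, Measurable[F] (Q i))
    (h : ∀ Z ∈ bddMeas F, (∀ i, ∀ g ∈ bddMeas G, ∫ ω, (g * (Z * Q i)) ω ∂μ = 0) → Z =ᵐ[μ] 0)
    (ξ : Ω → ℝ) (hξ : Measurable[F] ξ) :
    ∃ K : Fin n → Ω → ℝ, (∀ i, Measurable[G] (K i)) ∧
      ∀ᵐ ω ∂μ, ∑ i, K i ω * Q i ω = ξ ω := by
  -- Dividing by s makes ξ and all Q i bounded by 1 without changing the linear equation to be
  -- solved.
  set s : Ω → ℝ := fun ω => 1 + |ξ ω| + ∑ i, |Q i ω| with hs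
  have hs1 : ∀ ω, 1 ≤ s ω := fun ω => by
    have h1 : 0 ≤ ∑ i, |Q i ω| := Finset.sum_nonneg fun i _ => abs_nonneg _
    have h2 := abs_nonneg (ξ ω)
    simp only [hs]; linarith
  have hs0 : ∀ ω, 0 < s ω := fun ω => one_pos.trans_le (hs1 ω)
  have ms : Measurable[F] s := by
    refine (measurable_const.add ?_).add (Finset.measurable_sum _ fun i _ => ?_)
    · exact measurable_abs.comp hξ
    · exact measurable_abs.comp (hQ i)
  set r : Ω → ℝ := fun ω => (s ω)⁻¹ with hr
  have hr0 : ∀ ω, 0 < r ω := fun ω => inv_pos.2 (hs0 ω)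
  have scaled : ∀ f : Ω → ℝ, Measurable[F] f → (∀ ω, |f ω| ≤ s ω) → r * f ∈ bddMeas F := by
    refine fun f hf hfs => ⟨ms.inv.mul hf, 1, fun ω => ?_⟩
    rw [Pi.mul_apply, abs_mul, abs_of_pos (hr0 ω)]
    exact (mul_le_mul_of_nonneg_left (hfs ω) (hr0 ω).le).trans_eq (inv_mul_cancel₀ (hs0 ω).ne')
  have mr : r ∈ bddMeas F := by
    simpa using scaled 1 (measurable_const (a := (1 : ℝ))) fun ω => by simpa using hs1 ω
  have mrξ : r * ξ ∈ bddMeas F := scaled ξ hξ fun ω => by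
    have h1 : 0 ≤ ∑ i, |Q i ω| := Finset.sum_nonneg fun i _ => abs_nonneg _
    simp only [hs]; linarith
  have mrQ : ∀ i, r * Q i ∈ bddMeas F := fun i => scaled _ (hQ i) fun ω => by
    have h1 : |Q i ω| ≤ ∑ i, |Q i ω| :=
      Finset.single_le_sum (f := fun i => |Q i ω|) (fun i _ => abs_nonneg _) (Finset.mem_univ i)
    have h2 := abs_nonneg (ξ ω)
    simp only [hs]; linarith
  obtain ⟨w, hw, K, hK, hpos, hort⟩ := exists_cond_projection μ (hGF.trans hF) n
    (fun i => r * Q i) (fun i => bddMeas_mono hF (mrQ i)) (r * ξ) (bddMeas_mono hF mrξ)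
  set Z₀ := w * (r * ξ) - ∑ j, K j * (r * Q j) with hZ₀
  have mZ₀ : Z₀ ∈ bddMeas F := sub_mem (mul_mem (bddMeas_mono hGF hw) mrξ)
    (sum_mem fun j _ => mul_mem (bddMeas_mono hGF (hK j)) (mrQ j))
  -- Orthogonality of Z₀ to the scaled r Q i is orthogonality of Z₀ r to the Q i.
  have hZ := h (Z₀ * r) (mul_mem mZ₀ mr) fun i g hg => by
    rw [mul_assoc Z₀]; exact hort i g hg
  refine ⟨fun i ω => K i ω / w ω, fun i => (hK i).1.div hw.1, ?_⟩
  filter_upwards [hZ] with ω hω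
  have h0 : Z₀ ω = 0 := (mul_eq_zero.1 (show Z₀ ω * r ω = 0 from hω)).resolve_right (hr0 ω).ne'
  simp only [hZ₀, Pi.sub_apply, Pi.mul_apply, Finset.sum_apply] at h0
  have h1 : ∑ j, K j ω * (r ω * Q j ω) = r ω * ∑ j, K j ω * Q j ω := by
    rw [Finset.mul_sum]; exact Finset.sum_congr rfl fun j _ => by ring
  rw [h1] at h0
  have h2 : w ω * ξ ω = ∑ j, K j ω * Q j ω := by
    have : r ω * (w ω * ξ ω - ∑ j, K j ω * Q j ω) = 0 := by linear_combination h0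
    exact sub_eq_zero.1 ((mul_eq_zero.1 this).resolve_left (hr0 ω).ne')
  have h3 : ∑ i, K i ω / w ω * Q i ω = (∑ j, K j ω * Q j ω) / w ω := by
    rw [Finset.sum_div]; exact Finset.sum_congr rfl fun j _ => by ring
  rw [h3, ← h2, mul_div_cancel_left₀ _ (hpos ω).ne']

/-- If the deflator `Y` is unique, then nothing bounded and nonzero is conditionally orthogonal to
the deflated prices one step ahead. -/
lemma eq_zero_of_orthogonal {μ : Measure Ω} [IsFiniteMeasure μ] {ℱ : Filtration ℕ m}
    {P : ℕ → Ω → Fin n → ℝ} (hP : StronglyAdapted ℱ P) {Y : ℕ → Ω → ℝ}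
    (hY : IsMartingaleDeflator μ ℱ P Y) (hY0 : ∀ᵐ ω ∂μ, Y 0 ω = 1)
    (huniq : ∀ Y' : ℕ → Ω → ℝ, (IsMartingaleDeflator μ ℱ P Y' ∧ ∀ᵐ ω ∂μ, Y' 0 ω = 1) →
      ∀ᵐ ω ∂μ, ∀ t, Y' t ω = Y t ω)
    (t : ℕ) {Z : Ω → ℝ} (hZ : Z ∈ bddMeas (ℱ (t + 1)))
    (hort : ∀ i, ∀ g ∈ bddMeas (ℱ t),
      ∫ ω, (g * (Z * fun ω => Y (t + 1) ω * P (t + 1) ω i)) ω ∂μ = 0) : Z =ᵐ[μ] 0 := by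
  obtain ⟨hYa, hYpos, hYm⟩ := hY
  obtain ⟨-, hint, hI⟩ := martingale_pi_iff.1 hYm
  simp only [Pi.smul_apply, smul_eq_mul] at hint hI
  obtain ⟨-, C, hC⟩ := id hZ
  have hC0 : 0 < 2 * (|C| + 1) := by positivity
  -- This makes |cZ| ≤ 1/2, so V = 1 + cZ is bounded and positive.
  set c : ℝ := (2 * (|C| + 1))⁻¹ with hc
  have hc0 : 0 < c := inv_pos.2 hC0
  set V : Ω → ℝ := 1 + c • Z with hV
  have mV : V ∈ bddMeas (ℱ (t + 1)) := add_mem (one_mem _) (Subalgebra.smul_mem _ hZ c)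
  have hVpos : ∀ ω, 0 < V ω := by
    intro ω
    have h1 : |c * Z ω| ≤ c * (|C| + 1) := by
      rw [abs_mul, abs_of_pos hc0]
      exact mul_le_mul_of_nonneg_left ((hC ω).trans ((le_abs_self C).trans (by linarith))) hc0.le
    have h2 : c * (|C| + 1) = 1 / 2 := by rw [hc]; field_simp
    have h3 := neg_abs_le (c * Z ω)
    simp only [hV, Pi.add_apply, Pi.one_apply, Pi.smul_apply, smul_eq_mul]
    linarith
  -- Orthogonality of Z is needed only for the step from t to t+1; at later steps V is already known
  -- and is absorbed into the test function.
  set Y' : ℕ → Ω → ℝ := fun s => if s ≤ t then Y s else Y s * V with hY'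
  have hlow : ∀ s, s ≤ t → Y' s = Y s := fun s hs => by simp [hY', hs]
  have hhigh : ∀ s, t < s → Y' s = Y s * V := fun s hs => by simp [hY', hs]
  have hVs : ∀ s, t < s → V ∈ bddMeas (ℱ s) := fun s hs => bddMeas_mono (ℱ.mono hs) mV
  have hY'a : StronglyAdapted ℱ Y' := by
    intro s
    rcases le_or_gt s t with hs | hs
    · rw [hlow s hs]; exact hYa s
    · rw [hhigh s hs]; exact (hYa s).mul (hVs s hs).1.stronglyMeasurable
  have hbdd : ∀ {f : Ω → ℝ} {g : Ω → ℝ} (s : ℕ), g ∈ bddMeas (ℱ s) → Integrable f μ →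
      Integrable (fun ω => g ω * f ω) μ := by
    rintro f g s ⟨hg, D, hD⟩ hf
    exact hf.bdd_mul (hg.mono (ℱ.le s) le_rfl).aestronglyMeasurable (ae_of_all _ hD)
  have hdef : IsMartingaleDeflator μ ℱ P Y' := by
    refine ⟨hY'a, fun s => ?_, martingale_pi_iff.2 ⟨fun s => ?_, fun s i => ?_, ?_⟩⟩
    · rcases le_or_gt s t with hs | hs
      · rw [hlow s hs]; exact hYpos s
      · rw [hhigh s hs]
        filter_upwards [hYpos s] with ω hω using mul_pos hω (hVpos ω)
    · exact (hY'a s).smul (hP s)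
    · simp only [Pi.smul_apply, smul_eq_mul]
      rcases le_or_gt s t with hs | hs
      · rw [hlow s hs]; exact hint s i
      · rw [hhigh s hs]
        refine (hbdd s (hVs s hs) (hint s i)).congr (ae_of_all _ fun ω => ?_)
        simp only [Pi.mul_apply]; ring
    · intro s i g hg
      simp only [Pi.smul_apply, smul_eq_mul]
      rcases lt_trichotomy s t with hs | rfl | hs
      · rw [hlow s hs.le, hlow (s + 1) hs]; exact hI s i g hg
      · rw [hlow s le_rfl, hhigh (s + 1) s.lt_succ_self, ← hI s i g hg]
        have e : ∀ ω, g ω * ((Y (s + 1) * V) ω * P (s + 1) ω i) =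
            g ω * (Y (s + 1) ω * P (s + 1) ω i) +
              c * (g * (Z * fun ω => Y (s + 1) ω * P (s + 1) ω i)) ω := by
          intro ω
          simp only [hV, Pi.mul_apply, Pi.add_apply, Pi.one_apply, Pi.smul_apply, smul_eq_mul]
          ring
        simp only [e]
        rw [integral_add (hbdd s hg (hint (s + 1) i)), integral_const_mul, hort i g hg, mul_zero,
          add_zero]
        refine Integrable.const_mul ?_ c
        refine (hbdd (s + 1) (mul_mem (bddMeas_mono (ℱ.mono s.le_succ) hg) hZ)
          (hint (s + 1) i)).congr (ae_of_all _ fun ω => ?_)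
        simp only [Pi.mul_apply]; ring
      · rw [hhigh s hs, hhigh (s + 1) (hs.trans s.lt_succ_self)]
        have h1 := hI s i (g * V) (mul_mem hg (hVs s hs))
        have e : ∀ u ω, g ω * ((Y u * V) ω * P u ω i) = (g * V) ω * (Y u ω * P u ω i) := by
          intro u ω
          simp only [Pi.mul_apply]; ring
        simpa only [e] using h1
  have h0 := huniq Y' ⟨hdef, by rw [hlow 0 t.zero_le]; exact hY0⟩
  filter_upwards [h0, hYpos (t + 1)] with ω h1 h2
  have h3 := h1 (t + 1)
  rw [hhigh (t + 1) t.lt_succ_self] at h3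
  simp only [hV, Pi.mul_apply, Pi.add_apply, Pi.one_apply, Pi.smul_apply, smul_eq_mul] at h3
  have h4 : Y (t + 1) ω * c * Z ω = 0 := by linear_combination h3
  exact (mul_eq_zero.1 h4).resolve_left (mul_pos h2 hc0).ne'

/-- Equality at every rebalancing contains the self-financing inequality, and `H 0 = H 1` settles
measurability at time 0. -/
lemma isPureInvestment_iff {μ : Measure Ω} {ℱ : Filtration ℕ m}
    {P H : ℕ → Ω → Fin n → ℝ} :
    IsPureInvestment μ ℱ P H ↔ (∀ t, Measurable[ℱ t] (H (t + 1))) ∧ H 0 = H 1 ∧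
      ∀ t, 1 ≤ t → ∀ᵐ ω ∂μ, H t ω ⬝ᵥ P t ω = H (t + 1) ω ⬝ᵥ P t ω := by
  constructor
  · rintro ⟨⟨hp, -⟩, h0, h⟩
    refine ⟨fun t => (hp.measurable_add_one t).measurable, h0, fun t ht => ?_⟩
    filter_upwards [h t ht] with ω hω
    rwa [sub_dotProduct, sub_eq_zero] at hω
  · rintro ⟨hm, h0, h⟩
    refine ⟨⟨.of_measurable_add_one ?_ fun t => (hm t).stronglyMeasurable, fun t ht => ?_⟩, h0,
      fun t ht => ?_⟩
    · rw [h0]; exact (hm 0).stronglyMeasurable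
    · filter_upwards [h t ht] with ω hω using hω.ge
    · filter_upwards [h t ht] with ω hω
      rw [sub_dotProduct, hω, sub_self]

/-- Switching from a pure-investment strategy to a buy-and-hold position of the same value. -/
lemma IsPureInvestment.switch {μ : Measure Ω} {ℱ : Filtration ℕ m} {P H : ℕ → Ω → Fin n → ℝ}
    (hH : IsPureInvestment μ ℱ P H) {t : ℕ} (ht : 1 ≤ t) {K : Ω → Fin n → ℝ}
    (hK : Measurable[ℱ t] K) (hv : ∀ᵐ ω ∂μ, H t ω ⬝ᵥ P t ω = K ω ⬝ᵥ P t ω) :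
    IsPureInvestment μ ℱ P (fun s => if s ≤ t then H s else K) := by
  obtain ⟨h1, h2, h3⟩ := isPureInvestment_iff.1 hH
  refine isPureInvestment_iff.2 ⟨fun s => ?_, by simp [ht, h2], fun s hs => ?_⟩
  · by_cases h : s + 1 ≤ t
    · simp only [h, if_true]; exact h1 s
    · simp only [h, if_false]; exact hK.mono (ℱ.mono (by omega)) le_rfl
  · rcases lt_trichotomy s t with h | rfl | h
    · simpa [h.le, Nat.succ_le_of_lt h] using h3 s hs
    · simpa using hv
    · simp [h.not_ge, (h.trans s.lt_succ_self).not_ge]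

/-- Uniqueness of the martingale deflator implies completeness. -/
theorem isComplete_of_unique_deflator {μ : Measure Ω} [IsFiniteMeasure μ] {ℱ : Filtration ℕ m}
    {P : ℕ → Ω → Fin n → ℝ} (hP : StronglyAdapted ℱ P) {Y : ℕ → Ω → ℝ}
    (hY : IsMartingaleDeflator μ ℱ P Y) (hY0 : ∀ᵐ ω ∂μ, Y 0 ω = 1)
    (huniq : ∀ Y' : ℕ → Ω → ℝ, (IsMartingaleDeflator μ ℱ P Y' ∧ ∀ᵐ ω ∂μ, Y' 0 ω = 1) →
      ∀ᵐ ω ∂μ, ∀ t, Y' t ω = Y t ω) : IsComplete μ ℱ P := by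
  have step : ∀ t, ∀ ξ : Ω → ℝ, Measurable[ℱ (t + 1)] ξ → ∃ K : Ω → Fin n → ℝ,
      Measurable[ℱ t] K ∧ ∀ᵐ ω ∂μ, K ω ⬝ᵥ P (t + 1) ω = ξ ω := by
    intro t ξ hξ
    have hPm : ∀ i, Measurable[ℱ (t + 1)] fun ω => P (t + 1) ω i := fun i =>
      (measurable_pi_apply i).comp (hP (t + 1)).measurable
    obtain ⟨K, hK, h⟩ := exists_coeff_of_orthogonal_eq_zero (ℱ.mono t.le_succ) (ℱ.le (t + 1))
      (μ := μ) (fun i ω => Y (t + 1) ω * P (t + 1) ω i)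
      (fun i => (hY.1 (t + 1)).measurable.mul (hPm i))
      (fun Z hZ hort => eq_zero_of_orthogonal hP hY hY0 huniq t hZ hort)
      (fun ω => Y (t + 1) ω * ξ ω) ((hY.1 (t + 1)).measurable.mul hξ)
    refine ⟨fun ω i => K i ω, @measurable_pi_lambda _ _ _ (ℱ t) _ _ hK, ?_⟩
    filter_upwards [h, hY.2.1 (t + 1)] with ω h1 h2
    refine mul_left_cancel₀ h2.ne' ?_
    rw [← h1, dotProduct, Finset.mul_sum]
    exact Finset.sum_congr rfl fun i _ => by ring
  intro T hT
  obtain ⟨k, rfl⟩ : ∃ k, T = k + 1 := ⟨T - 1, by omega⟩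
  clear hT
  induction k with
  | zero =>
    intro ξ hξ
    obtain ⟨K, hK, h⟩ := step 0 ξ hξ
    exact ⟨fun _ => K, isPureInvestment_iff.2
      ⟨fun t => hK.mono (ℱ.mono t.zero_le) le_rfl, rfl, fun t _ => ae_of_all _ fun _ => rfl⟩, h⟩
  | succ k ih =>
    intro ξ hξ
    obtain ⟨K, hK, h⟩ := step (k + 1) ξ hξ
    -- The cost of the last one-period portfolio is itself a claim at time k+1, to be replicated by
    -- induction.
    have hm : Measurable[ℱ (k + 1)] fun ω => K ω ⬝ᵥ P (k + 1) ω := by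
      refine Finset.measurable_sum _ fun i _ => ?_
      exact ((measurable_pi_apply i).comp hK).mul
        ((measurable_pi_apply i).comp (hP (k + 1)).measurable)
    obtain ⟨H, hH, hHv⟩ := ih _ hm
    exact ⟨_, hH.switch (by omega) hK hHv, by simpa using h⟩

end MarketModel

/-! ### Positive functionals: continuity, densities, boundedness -/

namespace MarketModel

section PositiveFunctional

variable {Ω : Type*} {G m : MeasurableSpace Ω} {μ : Measure Ω}

/-- A positive linear functional on a real `L²` space is bounded. -/
lemma exists_bound_of_monotone (L : Lp ℝ 2 μ →ₗ[ℝ] ℝ) (hL : ∀ f g, f ≤ g → L f ≤ L g) :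
    ∃ C, ∀ f, ‖L f‖ ≤ C * ‖f‖ := by
  by_contra! hcon
  choose f hf using fun k : ℕ => hcon (4 ^ k)
  have hf0 : ∀ k, 0 < ‖f k‖ := fun k => norm_pos_iff.2 fun h0 => by
    have := hf k
    simp [h0] at this
  -- The norms 2⁻ᵏ are summable while L (u k) ≥ 2ᵏ; the sum dominates every u k, so its image under
  -- L would be infinite.
  set u : ℕ → Lp ℝ 2 μ := fun k => |((2 ^ k * ‖f k‖)⁻¹ : ℝ) • f k| with hu
  have hun : ∀ k, ‖u k‖ = (1 / 2) ^ k := by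
    intro k
    have h1 := (hf0 k).ne'
    rw [hu]
    simp only [norm_abs_eq_norm, norm_smul, norm_inv, norm_mul, norm_pow, norm_norm,
      Real.norm_ofNat, one_div, inv_pow]
    field_simp
  have hsum : Summable u := Summable.of_norm (by simpa only [hun] using summable_geometric_two)
  have hLu : ∀ k, (2 : ℝ) ^ k ≤ L (u k) := by
    intro k
    set c : ℝ := (2 ^ k * ‖f k‖)⁻¹ with hc
    have hc0 : 0 < c := inv_pos.2 (mul_pos (by positivity) (hf0 k))
    have h1 : |L (c • f k)| ≤ L (u k) := by
      refine abs_le'.2 ⟨hL _ _ (le_abs_self _), ?_⟩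
      rw [← map_neg]
      exact hL _ _ (neg_le_abs _)
    refine le_trans ?_ h1
    rw [map_smul, smul_eq_mul, abs_mul, abs_of_pos hc0]
    refine le_trans (le_of_eq ?_) (mul_le_mul_of_nonneg_left (hf k).le hc0.le)
    have h2 := (hf0 k).ne'
    have h4 : (4 : ℝ) ^ k = 2 ^ k * 2 ^ k := by rw [← mul_pow]; norm_num
    rw [hc, h4]
    field_simp
  obtain ⟨k, hk⟩ := pow_unbounded_of_one_lt (L (∑' k, u k)) (one_lt_two (α := ℝ))
  have h3 : u k ≤ ∑' k, u k := hsum.le_tsum k fun j _ => abs_nonneg _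
  linarith [hLu k, hL _ _ h3]

/-- A positive linear functional on the `G`-measurable functions is given on bounded functions by
a `G`-measurable integrable density. -/
theorem exists_density_of_monotone [IsFiniteMeasure μ] (hG : G ≤ m) (Φ : (Ω → ℝ) → ℝ)
    (hadd : ∀ f g, Measurable[G] f → Measurable[G] g → Φ (f + g) = Φ f + Φ g)
    (hsmul : ∀ (c : ℝ) f, Measurable[G] f → Φ (c • f) = c * Φ f)
    (hmono : ∀ f g, Measurable[G] f → Measurable[G] g → f ≤ᵐ[μ] g → Φ f ≤ Φ g) :
    ∃ Y : Ω → ℝ, Measurable[G] Y ∧ ∀ f ∈ bddMeas G, Φ f = ∫ ω, f ω * Y ω ∂μ := by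
  -- Classes in L² of the trimmed measure have `G`-measurable representatives, on which Φ can be
  -- evaluated.
  set ν := μ.trim hG with hν
  have hcongr : ∀ f g, Measurable[G] f → Measurable[G] g → f =ᵐ[ν] g → Φ f = Φ g := by
    intro f g hf hg h
    have h' := ae_eq_of_ae_eq_trim h
    exact le_antisymm (hmono f g hf hg h'.le) (hmono g f hg hf h'.symm.le)
  have hmeas : ∀ f : Lp ℝ 2 ν, Measurable[G] f := fun f => (Lp.stronglyMeasurable f).measurable
  let L : Lp ℝ 2 ν →ₗ[ℝ] ℝ :=
    { toFun := fun f => Φ f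
      map_add' := fun f g => by
        rw [← hadd _ _ (hmeas f) (hmeas g)]
        exact hcongr _ _ (hmeas _) ((hmeas f).add (hmeas g)) (Lp.coeFn_add f g)
      map_smul' := fun c f => by
        rw [RingHom.id_apply, smul_eq_mul, ← hsmul _ _ (hmeas f)]
        exact hcongr _ _ (hmeas _) ((hmeas f).const_smul c) (Lp.coeFn_smul c f) }
  have hL : ∀ f g, f ≤ g → L f ≤ L g := fun f g hfg =>
    hmono _ _ (hmeas f) (hmeas g) (ae_of_ae_trim hG ((Lp.coeFn_le f g).2 hfg))
  let L' := L.mkContinuousOfExistsBound (exists_bound_of_monotone L hL)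
  set y := (InnerProductSpace.toDual ℝ (Lp ℝ 2 ν)).symm L' with hy
  refine ⟨y, hmeas y, fun f hf => ?_⟩
  obtain ⟨hfm, C, hC⟩ := id hf
  have hfL : MemLp f 2 ν := MemLp.of_bound hfm.aestronglyMeasurable C (ae_of_all _ hC)
  have h1 : Φ f = L' (hfL.toLp f) :=
    hcongr _ _ hfm (hmeas _) hfL.coeFn_toLp.symm
  have h2 : inner ℝ y (hfL.toLp f) = L' (hfL.toLp f) := by
    rw [hy, InnerProductSpace.toDual_symm_apply]
  rw [h1, ← h2, L2.inner_def,
    integral_trim hG (f := fun ω => f ω * y ω) (hfm.mul (hmeas y)).stronglyMeasurable]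
  refine integral_congr_ae ?_
  filter_upwards [hfL.coeFn_toLp] with ω hω
  rw [hω]
  simp

/-- If the `G`-measurable functions carry a strictly positive linear functional, then they are all
essentially bounded. -/
theorem exists_bddMeas_ae_eq (Φ : (Ω → ℝ) → ℝ)
    (hadd : ∀ f g, Measurable[G] f → Measurable[G] g → Φ (f + g) = Φ f + Φ g)
    (hsmul : ∀ (c : ℝ) f, Measurable[G] f → Φ (c • f) = c * Φ f)
    (hmono : ∀ f g, Measurable[G] f → Measurable[G] g → f ≤ᵐ[μ] g → Φ f ≤ Φ g)
    (hpos : ∀ f, Measurable[G] f → 0 ≤ᵐ[μ] f → Φ f ≤ 0 → f =ᵐ[μ] 0)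
    (f : Ω → ℝ) (hf : Measurable[G] f) : ∃ f' ∈ bddMeas G, f =ᵐ[μ] f' := by
  have hfa : Measurable[G] fun ω => |f ω| := measurable_abs.comp hf
  suffices h : ∃ k : ℕ, ∀ᵐ ω ∂μ, |f ω| ≤ k by
    obtain ⟨k, hk⟩ := h
    have hs : MeasurableSet[G] {ω | |f ω| ≤ k} := measurableSet_le hfa measurable_const
    refine ⟨Set.indicator {ω | |f ω| ≤ k} f, ⟨hf.indicator hs, k, fun ω => ?_⟩, ?_⟩
    · by_cases h : |f ω| ≤ k <;> simp [h]
    · filter_upwards [hk] with ω hω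
      simp [hω]
  by_contra! hcon
  set e : ℕ → Ω → ℝ := fun k => Set.indicator {ω | (k : ℝ) < |f ω|} 1 with he
  have me : ∀ k, Measurable[G] (e k) := fun k =>
    (measurable_const (a := (1 : ℝ))).indicator (measurableSet_lt measurable_const hfa)
  have ha : ∀ k, 0 < Φ (e k) := by
    intro k
    by_contra! hk
    refine hcon k ?_
    filter_upwards [hpos _ (me k)
      (ae_of_all _ fun ω => Set.indicator_nonneg (fun _ _ => zero_le_one) ω) hk] with ω hω
    by_contra! h
    simp [he, h] at hω
  -- Pointwise a finite sum over k < |f|, yet above every partial sum of e k / Φ(e k); the first N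
  -- terms have price N, so Φ g exceeds every N.
  set g : Ω → ℝ := fun ω => ∑ k ∈ Finset.range ⌈|f ω|⌉₊, (Φ (e k))⁻¹ with hg
  have mg : Measurable[G] g := by
    have h1 : Measurable fun j : ℕ => ∑ k ∈ Finset.range j, (Φ (e k))⁻¹ := measurable_from_nat
    exact h1.comp (Nat.measurable_ceil.comp hfa)
  have hsum : ∀ N : ℕ, Measurable[G] (∑ k ∈ Finset.range N, (Φ (e k))⁻¹ • e k) ∧
      Φ (∑ k ∈ Finset.range N, (Φ (e k))⁻¹ • e k) = N := by
    intro N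
    induction N with
    | zero => exact ⟨measurable_const (a := (0 : ℝ)), by
      simpa using hsmul 0 0 (measurable_const (a := (0 : ℝ)))⟩
    | succ N ih =>
      have h1 := (me N).const_smul (Φ (e N))⁻¹
      rw [Finset.sum_range_succ]
      refine ⟨ih.1.add h1, ?_⟩
      rw [hadd _ _ ih.1 h1, ih.2, hsmul _ _ (me N), inv_mul_cancel₀ (ha N).ne']
      push_cast; ring
  obtain ⟨N, hN⟩ := exists_nat_gt (Φ g)
  have hle : ∑ k ∈ Finset.range N, (Φ (e k))⁻¹ • e k ≤ g := by
    intro ω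
    simp only [Finset.sum_apply, Pi.smul_apply, smul_eq_mul, he, Set.indicator_apply,
      Set.mem_ofPred_eq, Pi.one_apply, mul_ite, mul_one, mul_zero]
    rw [← Finset.sum_filter]
    refine Finset.sum_le_sum_of_subset_of_nonneg (fun k hk => ?_) fun k _ _ =>
      (inv_pos.2 (ha k)).le
    exact Finset.mem_range.2 (Nat.lt_ceil.2 (Finset.mem_filter.1 hk).2)
  have := hmono _ _ (hsum N).1 mg (ae_of_all _ hle)
  rw [(hsum N).2] at this
  linarith

end PositiveFunctional

end MarketModel

/-! ### Completeness implies a unique deflator -/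

namespace MarketModel

variable {Ω : Type*} {m : MeasurableSpace Ω} {n : ℕ} {μ : Measure Ω} {ℱ : Filtration ℕ m}
  {P H H' : ℕ → Ω → Fin n → ℝ}

lemma measurable_dotProduct {G : MeasurableSpace Ω} {f g : Ω → Fin n → ℝ}
    (hf : Measurable[G] f) (hg : Measurable[G] g) : Measurable[G] fun ω => f ω ⬝ᵥ g ω :=
  Finset.measurable_sum _ fun i _ =>
    ((measurable_pi_apply i).comp hf).mul ((measurable_pi_apply i).comp hg)

lemma IsPureInvestment.add (hH : IsPureInvestment μ ℱ P H) (hH' : IsPureInvestment μ ℱ P H') :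
    IsPureInvestment μ ℱ P (H + H') := by
  obtain ⟨h1, h2, h3⟩ := isPureInvestment_iff.1 hH
  obtain ⟨h1', h2', h3'⟩ := isPureInvestment_iff.1 hH'
  refine isPureInvestment_iff.2 ⟨fun t => (h1 t).add (h1' t), by simp [h2, h2'], fun t ht => ?_⟩
  filter_upwards [h3 t ht, h3' t ht] with ω e e'
  simp only [Pi.add_apply, add_dotProduct, e, e']

lemma IsPureInvestment.smul (hH : IsPureInvestment μ ℱ P H) (c : ℝ) :
    IsPureInvestment μ ℱ P (c • H) := by
  obtain ⟨h1, h2, h3⟩ := isPureInvestment_iff.1 hH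
  refine isPureInvestment_iff.2 ⟨fun t => (h1 t).const_smul c, by simp [h2], fun t ht => ?_⟩
  filter_upwards [h3 t ht] with ω e
  simp only [Pi.smul_apply, smul_dotProduct, e]

/-- Without arbitrage, a nonnegative terminal value has a positive initial cost unless both
vanish. -/
theorem NoArbitrage.cost_pos_or_eq_zero (hNA : NoArbitrage μ ℱ P) (hP : StronglyAdapted ℱ P)
    (hH : IsPureInvestment μ ℱ P H) {T : ℕ} (hT : 0 < T)
    (hv : ∀ᵐ ω ∂μ, 0 ≤ H T ω ⬝ᵥ P T ω) :
    ∀ᵐ ω ∂μ, 0 < H 1 ω ⬝ᵥ P 0 ω ∨ (H 1 ω ⬝ᵥ P 0 ω = 0 ∧ H T ω ⬝ᵥ P T ω = 0) := by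
  obtain ⟨h1, h2, h3⟩ := isPureInvestment_iff.1 hH
  set B : Set Ω := {ω | H 1 ω ⬝ᵥ P 0 ω ≤ 0} with hB
  have mB : MeasurableSet[ℱ 0] B :=
    measurableSet_le (measurable_dotProduct (h1 0) (hP 0).measurable) measurable_const
  -- Follow H where its initial cost is nonpositive and liquidate at T. As `J 0 = 0`, consumption
  -- there is −H₁·P₀ at time 0 and H_T·P_T at time T; both are nonnegative, so both must vanish.
  set J : ℕ → Ω → Fin n → ℝ := fun s => if s = 0 then 0 else if s ≤ T then B.indicator (H s) else 0
    with hJ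
  have J0 : J 0 = 0 := by simp [hJ]
  have Jlow : ∀ s, 1 ≤ s → s ≤ T → J s = B.indicator (H s) := fun s h h' => by
    simp only [hJ, if_neg (Nat.one_le_iff_ne_zero.1 h), if_pos h']
  have Jhigh : ∀ s, T < s → J s = 0 := fun s h => by
    simp [hJ, h.not_ge]
  have hfeas : J ∈ Feasible μ ℱ P 0 T := by
    refine ⟨⟨.of_measurable_add_one ?_ fun t => ?_, fun t ht => ?_⟩, ?_, ?_⟩
    · rw [J0]; exact stronglyMeasurable_const (b := (0 : Fin n → ℝ))
    · rcases le_or_gt (t + 1) T with h | h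
      · rw [Jlow _ (by omega) h]
        exact ((h1 t).indicator (ℱ.mono t.zero_le _ mB)).stronglyMeasurable
      · rw [Jhigh _ h]; exact stronglyMeasurable_const (b := (0 : Fin n → ℝ))
    · rcases lt_trichotomy t T with h | rfl | h
      · rw [Jlow _ ht h.le, Jlow _ (by omega) h]
        filter_upwards [h3 t ht] with ω hω
        by_cases hb : ω ∈ B <;> simp [hb, hω]
      · rw [Jlow _ ht le_rfl, Jhigh _ t.lt_succ_self]
        filter_upwards [hv] with ω hω
        by_cases hb : ω ∈ B <;> simp [hb, hω]
      · rw [Jhigh _ h, Jhigh _ (h.trans t.lt_succ_self)]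
        exact ae_of_all _ fun ω => le_rfl
    · rw [Jlow 1 le_rfl hT]
      refine ae_of_all _ fun ω => ?_
      by_cases hb : ω ∈ B
      · rw [Set.indicator_of_mem hb]; exact hb
      · simp [hb]
    · rw [Jhigh _ T.lt_succ_self]
      exact ae_of_all _ fun ω => rfl
  have hzero : ∀ᵐ ω ∂μ, ¬ ∃ t, t ≤ T ∧ 0 < (J t ω - J (t + 1) ω) ⬝ᵥ P t ω := by
    rw [ae_iff]
    simp only [not_not]
    by_contra hne
    exact hNA ⟨J, J0, T, hT, hfeas, pos_iff_ne_zero.2 hne⟩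
  filter_upwards [hzero, hv] with ω hω hvω
  push Not at hω
  by_cases hb : ω ∈ B
  · right
    have e0 := hω 0 T.zero_le
    have eT := hω T le_rfl
    rw [J0, zero_add, Jlow 1 le_rfl hT, Set.indicator_of_mem hb] at e0
    rw [Jlow T hT le_rfl, Jhigh _ T.lt_succ_self, Set.indicator_of_mem hb] at eT
    simp only [Pi.zero_apply, zero_sub, neg_dotProduct, sub_zero] at e0 eT
    have hb' : H 1 ω ⬝ᵥ P 0 ω ≤ 0 := hb
    exact ⟨by linarith, by linarith⟩
  · left
    exact lt_of_not_ge hb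

/-- Preimages of Borel sets have probability 0 or 1, and countably many Borel sets separate the
points of ℝ. -/
lemma exists_ae_eq_const [IsProbabilityMeasure μ] {G : MeasurableSpace Ω} (hG : G ≤ m)
    (h01 : ∀ s, MeasurableSet[G] s → μ s = 0 ∨ μ s = 1) {f : Ω → ℝ} (hf : Measurable[G] f) :
    ∃ c : ℝ, ∀ᵐ ω ∂μ, f ω = c := by
  refine Filter.exists_eventuallyEq_const_of_forall_separating MeasurableSet fun U hU => ?_
  have hs : MeasurableSet[G] (f ⁻¹' U) := hf hU
  rcases h01 _ hs with h | h
  · right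
    exact measure_eq_zero_iff_ae_notMem.1 h
  · left
    exact (prob_compl_eq_zero_iff (hG _ hs)).2 h

/-- In a complete market without arbitrage, replication costs at horizon `T` define a price
functional. -/
theorem exists_price [IsProbabilityMeasure μ]
    (hℱ : ∀ s, MeasurableSet[ℱ 0] s → μ s = 0 ∨ μ s = 1) (hP : StronglyAdapted ℱ P)
    (hNA : NoArbitrage μ ℱ P) (hc : IsComplete μ ℱ P) {T : ℕ} (hT : 0 < T) :
    ∃ Φ : (Ω → ℝ) → ℝ, ∀ f, Measurable[ℱ T] f → ∀ H, IsPureInvestment μ ℱ P H →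
      (∀ᵐ ω ∂μ, H T ω ⬝ᵥ P T ω = f ω) → ∀ᵐ ω ∂μ, H 1 ω ⬝ᵥ P 0 ω = Φ f := by
  have key : ∀ f, ∃ c : ℝ, Measurable[ℱ T] f → ∀ H, IsPureInvestment μ ℱ P H →
      (∀ᵐ ω ∂μ, H T ω ⬝ᵥ P T ω = f ω) → ∀ᵐ ω ∂μ, H 1 ω ⬝ᵥ P 0 ω = c := by
    intro f
    by_cases hf : Measurable[ℱ T] f
    swap
    · exact ⟨0, fun h => absurd h hf⟩
    obtain ⟨H₀, hH₀, hv₀⟩ := hc T hT f hf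
    obtain ⟨c, hc⟩ := exists_ae_eq_const (ℱ.le 0) hℱ
      (measurable_dotProduct ((isPureInvestment_iff.1 hH₀).1 0) (hP 0).measurable)
    refine ⟨c, fun _ H hH hv => ?_⟩
    -- Law of one price: A − B ends at zero, so its initial cost cannot be negative; exchanging A
    -- and B gives equality.
    have aux : ∀ {A B : ℕ → Ω → Fin n → ℝ}, IsPureInvestment μ ℱ P A → IsPureInvestment μ ℱ P B →
        (∀ᵐ ω ∂μ, A T ω ⬝ᵥ P T ω = f ω) → (∀ᵐ ω ∂μ, B T ω ⬝ᵥ P T ω = f ω) →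
        ∀ᵐ ω ∂μ, B 1 ω ⬝ᵥ P 0 ω ≤ A 1 ω ⬝ᵥ P 0 ω := by
      intro A B hA hB hvA hvB
      have := hNA.cost_pos_or_eq_zero hP (hA.add (hB.smul (-1))) hT (by
        filter_upwards [hvA, hvB] with ω e e'
        simp [add_dotProduct, e, e'])
      filter_upwards [this] with ω h
      simp only [Pi.add_apply, Pi.smul_apply, add_dotProduct, smul_dotProduct, smul_eq_mul] at h
      rcases h with h | h
      · linarith
      · linarith [h.1]
    filter_upwards [aux hH hH₀ hv hv₀, aux hH₀ hH hv₀ hv, hc] with ω h1 h2 h3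
    rw [← h3]
    exact le_antisymm h2 h1
  choose Φ hΦ using key
  exact ⟨Φ, hΦ⟩

/-- In a complete market without arbitrage, the time-`T` measurable functions are essentially
bounded, and replication costs have a strictly positive density. -/
theorem exists_state_price_density [IsProbabilityMeasure μ]
    (hℱ : ∀ s, MeasurableSet[ℱ 0] s → μ s = 0 ∨ μ s = 1) (hP : StronglyAdapted ℱ P)
    (hNA : NoArbitrage μ ℱ P) (hc : IsComplete μ ℱ P) {T : ℕ} (hT : 0 < T) :
    (∀ f, Measurable[ℱ T] f → ∃ f' ∈ bddMeas (ℱ T), f =ᵐ[μ] f') ∧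
    ∃ Y : Ω → ℝ, Measurable[ℱ T] Y ∧ (∀ᵐ ω ∂μ, 0 < Y ω) ∧
      ∀ f, Measurable[ℱ T] f → ∀ H, IsPureInvestment μ ℱ P H →
        (∀ᵐ ω ∂μ, H T ω ⬝ᵥ P T ω = f ω) →
          ∀ᵐ ω ∂μ, H 1 ω ⬝ᵥ P 0 ω = ∫ ω', f ω' * Y ω' ∂μ := by
  obtain ⟨Φ, hΦ⟩ := exists_price hℱ hP hNA hc hT
  have hadd : ∀ f g, Measurable[ℱ T] f → Measurable[ℱ T] g → Φ (f + g) = Φ f + Φ g := by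
    intro f g hf hg
    obtain ⟨A, hA, hvA⟩ := hc T hT f hf
    obtain ⟨B, hB, hvB⟩ := hc T hT g hg
    have h := hΦ (f + g) (hf.add hg) (A + B) (hA.add hB) (by
      filter_upwards [hvA, hvB] with ω e e'
      simp [add_dotProduct, e, e'])
    obtain ⟨ω, h1, h2, h3⟩ := (h.and ((hΦ f hf A hA hvA).and (hΦ g hg B hB hvB))).exists
    rw [← h1, ← h2, ← h3, Pi.add_apply, Pi.add_apply, add_dotProduct]
  have hsmul : ∀ (c : ℝ) f, Measurable[ℱ T] f → Φ (c • f) = c * Φ f := by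
    intro c f hf
    obtain ⟨A, hA, hvA⟩ := hc T hT f hf
    have h := hΦ (c • f) (hf.const_smul c) (c • A) (hA.smul c) (by
      filter_upwards [hvA] with ω e
      simp [smul_dotProduct, e])
    obtain ⟨ω, h1, h2⟩ := (h.and (hΦ f hf A hA hvA)).exists
    rw [← h1, ← h2, Pi.smul_apply, Pi.smul_apply, smul_dotProduct, smul_eq_mul]
  have hnn : ∀ f, Measurable[ℱ T] f → 0 ≤ᵐ[μ] f → 0 ≤ Φ f ∧ (Φ f ≤ 0 → f =ᵐ[μ] 0) := by
    intro f hf h0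
    obtain ⟨A, hA, hvA⟩ := hc T hT f hf
    have h1 := hNA.cost_pos_or_eq_zero hP hA hT (by
      filter_upwards [hvA, h0] with ω e e'
      rw [e]; exact e')
    have h2 := hΦ f hf A hA hvA
    constructor
    · obtain ⟨ω, h3, h4⟩ := (h1.and h2).exists
      rw [h4] at h3
      exact h3.elim le_of_lt fun h => h.1.ge
    · intro hle
      filter_upwards [h1, h2, hvA] with ω h3 h4 h5
      rw [h4, h5] at h3
      exact h3.elim (fun h => absurd h hle.not_gt) fun h => h.2
  have hmono : ∀ f g, Measurable[ℱ T] f → Measurable[ℱ T] g → f ≤ᵐ[μ] g → Φ f ≤ Φ g := by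
    intro f g hf hg hfg
    have h1 := (hnn (g + (-1 : ℝ) • f) (hg.add (hf.const_smul _)) (by
      filter_upwards [hfg] with ω e
      simpa using e)).1
    rw [hadd _ _ hg (hf.const_smul _), hsmul _ _ hf] at h1
    linarith
  have hbdd : ∀ f, Measurable[ℱ T] f → ∃ f' ∈ bddMeas (ℱ T), f =ᵐ[μ] f' :=
    exists_bddMeas_ae_eq Φ hadd hsmul hmono fun f hf h0 => (hnn f hf h0).2
  obtain ⟨Y, hYm, hY⟩ := exists_density_of_monotone (ℱ.le T) Φ hadd hsmul hmono
  refine ⟨hbdd, Y, hYm, ?_, fun f hf H hH hv => ?_⟩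
  · have hs : MeasurableSet[ℱ T] {ω | Y ω ≤ 0} := measurableSet_le hYm measurable_const
    have he := indicator_mem_bddMeas hs
    -- The claim paying 1 where Y ≤ 0 has nonpositive price, hence is null.
    have h1 : Φ (Set.indicator {ω | Y ω ≤ 0} 1) ≤ 0 := by
      rw [hY _ he]
      refine integral_nonpos fun ω => ?_
      by_cases h : Y ω ≤ 0 <;> simp [h]
    filter_upwards [(hnn _ he.1 (ae_of_all _ fun ω =>
      Set.indicator_nonneg (fun _ _ => zero_le_one) ω)).2 h1] with ω hω
    by_contra! h
    simp [h] at hω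
  · obtain ⟨f', hf', hff'⟩ := hbdd f hf
    have h1 := hΦ f' hf'.1 H hH (by filter_upwards [hv, hff'] with ω e e'; rw [e, e'])
    rw [hY f' hf'] at h1
    filter_upwards [h1] with ω hω
    rw [hω]
    refine integral_congr_ae ?_
    filter_upwards [hff'] with ω' h
    rw [h]

/-- A complete market without arbitrage has exactly one normalised martingale deflator. -/
theorem exists_unique_deflator_of_isComplete [IsProbabilityMeasure μ]
    (hℱ : ∀ s, MeasurableSet[ℱ 0] s → μ s = 0 ∨ μ s = 1) (hP : StronglyAdapted ℱ P)
    (hNA : NoArbitrage μ ℱ P) (hc : IsComplete μ ℱ P) :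
    ∃ Y : ℕ → Ω → ℝ, (IsMartingaleDeflator μ ℱ P Y ∧ ∀ᵐ ω ∂μ, Y 0 ω = 1) ∧
      ∀ Y' : ℕ → Ω → ℝ, (IsMartingaleDeflator μ ℱ P Y' ∧ ∀ᵐ ω ∂μ, Y' 0 ω = 1) →
        ∀ᵐ ω ∂μ, ∀ t, Y' t ω = Y t ω := by
  have hex := fun t => exists_state_price_density hℱ hP hNA hc (Nat.succ_pos t)
  choose hbdd' D hDm hDpos hD using hex
  have hbdd : ∀ t (f : Ω → ℝ), Measurable[ℱ t] f → ∃ f' ∈ bddMeas (ℱ t), f =ᵐ[μ] f' := by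
    intro t f hf
    cases t with
    | zero =>
      obtain ⟨c, hc⟩ := exists_ae_eq_const (ℱ.le 0) hℱ hf
      exact ⟨fun _ => c, (bddMeas (ℱ 0)).algebraMap_mem c, hc⟩
    | succ t => exact hbdd' t f hf
  have hint : ∀ t (f : Ω → ℝ), Measurable[ℱ t] f → Integrable f μ := by
    intro t f hf
    obtain ⟨f', hf', h⟩ := hbdd t f hf
    exact (integrable_of_mem_bddMeas (bddMeas_mono (ℱ.le t) hf')).congr h.symm
  have hPm : ∀ t i, Measurable[ℱ t] fun ω => P t ω i := fun t i =>
    (measurable_pi_apply i).comp (hP t).measurable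
  have hDe : ∀ t f, Measurable[ℱ (t + 1)] f → ∀ H, IsPureInvestment μ ℱ P H →
      (∀ᵐ ω ∂μ, H (t + 1) ω ⬝ᵥ P (t + 1) ω = f ω) →
        ∀ᵐ ω ∂μ, H 1 ω ⬝ᵥ P 0 ω = ∫ ω', f ω' * D t ω' ∂μ := hD
  -- `D t` belongs to horizon t+1, so the value 1 at time 0 is put in by hand.
  set Y : ℕ → Ω → ℝ := fun t => t.casesOn 1 D with hY
  have hYa : StronglyAdapted ℱ Y := by
    intro t
    cases t with
    | zero => exact stronglyMeasurable_const (b := (1 : ℝ))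
    | succ t => exact (hDm t).stronglyMeasurable
  have hYd : IsMartingaleDeflator μ ℱ P Y := by
    refine ⟨hYa, fun t => ?_, martingale_pi_iff.2 ⟨fun t => (hYa t).smul (hP t), fun t i => ?_, ?_⟩⟩
    · cases t with
      | zero => exact ae_of_all _ fun _ => one_pos
      | succ t => exact hDpos t
    · exact hint t _ ((hYa t).measurable.mul (hPm t i))
    · intro t i g hg
      simp only [Pi.smul_apply, smul_eq_mul]
      have hgP : ∀ u, t ≤ u → Measurable[ℱ u] fun ω => g ω * P u ω i := fun u hu =>
        (hg.1.mono (ℱ.mono hu) le_rfl).mul (hPm u i)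
      -- K holds g units of asset i. Replicating g Pᵢ up to time t and then switching to K has one
      -- initial cost, which the densities at t and t+1 both compute. For t = 0, K is bought at
      -- once.
      set K : Ω → Fin n → ℝ := fun ω => Pi.single i (g ω) with hK
      have mK : Measurable[ℱ t] K :=
        @measurable_pi_lambda _ _ _ (ℱ t) _ _ fun j => by
          by_cases h : j = i
          · subst h; simpa [hK] using hg.1
          · simp [hK, h]
      have hKP : ∀ u ω, K ω ⬝ᵥ P u ω = g ω * P u ω i := fun u ω => single_dotProduct ..
      have comm : ∀ u, ∫ ω, g ω * (Y u ω * P u ω i) ∂μ = ∫ ω, g ω * P u ω i * Y u ω ∂μ :=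
        fun u => congrArg _ (funext fun ω => by ring)
      refine (comm (t + 1)).trans (Eq.trans ?_ (comm t).symm)
      cases t with
      | zero =>
        have h1 := hDe 0 _ (hgP 1 (Nat.zero_le _)) (fun _ => K) (isPureInvestment_iff.2
          ⟨fun s => mK.mono (ℱ.mono s.zero_le) le_rfl, rfl, fun _ _ => ae_of_all _ fun _ => rfl⟩)
          (ae_of_all _ fun ω => hKP _ ω)
        have h2 : (fun ω => g ω * P 0 ω i * Y 0 ω) =ᵐ[μ]
            fun _ => ∫ ω', g ω' * P 1 ω' i * D 0 ω' ∂μ := by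
          filter_upwards [h1] with ω hω
          rw [← hω, hKP]
          exact mul_one _
        rw [integral_congr_ae h2]
        simp [hY]
      | succ t =>
        obtain ⟨H, hH, hv⟩ := hc (t + 1) t.succ_pos _ (hgP (t + 1) le_rfl)
        have h1 := hDe t _ (hgP (t + 1) le_rfl) H hH hv
        have h2 := hDe (t + 1) _ (hgP (t + 2) (by omega)) _ (hH.switch (by omega) mK (by
          filter_upwards [hv] with ω e; rw [e, hKP])) (ae_of_all _ fun ω => by simpa using hKP _ ω)
        obtain ⟨ω, h3, h4⟩ := (h1.and h2).exists
        simp only [le_add_iff_nonneg_left, zero_le, if_true] at h4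
        exact h4.symm.trans h3
  have hval : ∀ V : ℕ → Ω → ℝ, IsMartingaleDeflator μ ℱ P V → ∀ H, IsPureInvestment μ ℱ P H →
      ∀ t, ∫ ω, V (t + 1) ω * (H (t + 1) ω ⬝ᵥ P (t + 1) ω) ∂μ =
        ∫ ω, V 0 ω * (H 1 ω ⬝ᵥ P 0 ω) ∂μ := by
    intro V hV H hH
    obtain ⟨h1, -, h3⟩ := isPureInvestment_iff.1 hH
    obtain ⟨-, -, hI⟩ := martingale_pi_iff.1 hV.2.2
    simp only [Pi.smul_apply, smul_eq_mul] at hI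
    have step : ∀ t, ∫ ω, V (t + 1) ω * (H (t + 1) ω ⬝ᵥ P (t + 1) ω) ∂μ =
        ∫ ω, V t ω * (H (t + 1) ω ⬝ᵥ P t ω) ∂μ := by
      intro t
      have mH : ∀ i, Measurable[ℱ t] fun ω => H (t + 1) ω i := fun i =>
        (measurable_pi_apply i).comp (h1 t)
      have e : ∀ u, t ≤ u → ∫ ω, V u ω * (H (t + 1) ω ⬝ᵥ P u ω) ∂μ =
          ∑ i, ∫ ω, H (t + 1) ω i * (V u ω * P u ω i) ∂μ := by
        intro u hu
        rw [← integral_finsetSum _ fun i _ => hint u (fun ω => H (t + 1) ω i * (V u ω * P u ω i))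
          (((mH i).mono (ℱ.mono hu) le_rfl).mul ((hV.1 u).measurable.mul (hPm u i)))]
        refine integral_congr_ae (ae_of_all _ fun ω => ?_)
        simp only [dotProduct, Finset.mul_sum]
        exact Finset.sum_congr rfl fun i _ => by ring
      rw [e _ t.le_succ, e _ le_rfl]
      refine Finset.sum_congr rfl fun i _ => ?_
      -- Essential boundedness lets the holdings serve as test functions in the martingale property.
      obtain ⟨g, hg, hHg⟩ := hbdd t _ (mH i)
      have e' : ∀ u, ∫ ω, H (t + 1) ω i * (V u ω * P u ω i) ∂μ =
          ∫ ω, g ω * (V u ω * P u ω i) ∂μ := fun u => by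
        refine integral_congr_ae ?_
        filter_upwards [hHg] with ω hω
        rw [hω]
      rw [e', e', hI t i g hg]
    intro t
    induction t with
    | zero => exact step 0
    | succ t ih =>
      rw [step (t + 1), ← ih]
      refine integral_congr_ae ?_
      filter_upwards [h3 (t + 1) t.succ_pos] with ω hω
      rw [hω]
  refine ⟨Y, ⟨hYd, ae_of_all _ fun _ => rfl⟩, fun V ⟨hV, hV0⟩ => ae_all_iff.2 fun t => ?_⟩
  cases t with
  | zero => exact hV0
  | succ t =>
    have mf : Measurable[ℱ (t + 1)] (V (t + 1) - Y (t + 1)) :=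
      (hV.1 (t + 1)).measurable.sub (hYa (t + 1)).measurable
    -- Both deflators price the replicated difference at the same initial cost, so E[(V − Y)²] = 0
    -- at time t+1.
    obtain ⟨H, hH, hv⟩ := hc (t + 1) t.succ_pos _ mf
    have h1 : ∫ ω, V 0 ω * (H 1 ω ⬝ᵥ P 0 ω) ∂μ = ∫ ω, Y 0 ω * (H 1 ω ⬝ᵥ P 0 ω) ∂μ := by
      refine integral_congr_ae ?_
      filter_upwards [hV0] with ω hω
      rw [hω]
      rfl
    rw [← hval V hV H hH t, ← hval Y hYd H hH t] at h1
    have e : ∀ W : ℕ → Ω → ℝ, ∫ ω, W (t + 1) ω * (H (t + 1) ω ⬝ᵥ P (t + 1) ω) ∂μ =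
        ∫ ω, (W (t + 1) * (V (t + 1) - Y (t + 1))) ω ∂μ := fun W => by
      refine integral_congr_ae ?_
      filter_upwards [hv] with ω hω
      rw [hω, Pi.mul_apply]
    rw [e, e, ← sub_eq_zero, ← integral_sub' (hint _ _ ((hV.1 (t + 1)).measurable.mul mf))
      (hint _ _ ((hYa (t + 1)).measurable.mul mf))] at h1
    rw [← sub_mul] at h1
    have h2 := (integral_eq_zero_iff_of_nonneg (fun ω => mul_self_nonneg _)
      (hint _ _ (mf.mul mf))).1 h1
    filter_upwards [h2] with ω hω
    exact sub_eq_zero.1 (mul_self_eq_zero.1 hω)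

end MarketModel

/-- Second fundamental theorem of asset pricing, without a numéraire. Processes are identified
when they are almost surely equal at all times. -/
theorem mainTheorem4 {Ω : Type*} {m : MeasurableSpace Ω} (μ : Measure Ω) [IsProbabilityMeasure μ]
    (ℱ : Filtration ℕ m)
    (hℱ : ∀ s, MeasurableSet[ℱ 0] s → μ s = 0 ∨ μ s = 1)
    (n : ℕ) (P : ℕ → Ω → Fin n → ℝ) (hP : StronglyAdapted ℱ P)
    (hNA : MarketModel.NoArbitrage μ ℱ P) :
    MarketModel.IsComplete μ ℱ P ↔
      ∃ Y : ℕ → Ω → ℝ,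
        (MarketModel.IsMartingaleDeflator μ ℱ P Y ∧ ∀ᵐ ω ∂μ, Y 0 ω = 1) ∧
        ∀ Y' : ℕ → Ω → ℝ,
          (MarketModel.IsMartingaleDeflator μ ℱ P Y' ∧ ∀ᵐ ω ∂μ, Y' 0 ω = 1) →
            ∀ᵐ ω ∂μ, ∀ t, Y' t ω = Y t ω := by
  exact ⟨MarketModel.exists_unique_deflator_of_isComplete hℱ hP hNA, fun ⟨_, ⟨hY, hY0⟩, huniq⟩ =>
    MarketModel.isComplete_of_unique_deflator hP hY hY0 huniq⟩
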